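/- Let $M$ be a closed, connected, oriented $3$-manifold with a (possibly singular, i.e. semi-simplicial) triangulation $\mathcal T$, obtained by gluing the faces of finitely many oriented tetrahedra in pairs by orientation-reversing affine maps. Assume that every edge of $\mathcal T$ is essential (no edge is a null-homotopic loop). Let $\rho:\pi_1(M)\to PSL(2,\mathbb C)$ be a representation with $\rho([e])\neq 1$ for every edge $e$ of $\mathcal T$ that is a loop. Let $\pi:\widetilde M\to M$ be the universal cover, on which $\pi_1(M)$ acts by deck transformations, $\widetilde{\mathcal T}$ the lifted triangulation and $V$ the set of vertices of $\mathcal T$. For four distinct points $v_1,\dots,v_4\in S^2_\infty=\mathbb C\cup\{\infty\}$, labelled compatibly with the orientation of a tetrahedron, the shape parameter of the ideal tetrahedron with these vertices at the edge $v_iv_j$ is the cross-ratio $\frac{v_i-v_k}{v_i-v_l}\cdot\frac{v_j-v_l}{v_j-v_k}$, where $(i,j,k,l)$ is an even permutation of $(1,2,3,4)$; opposite edges have the same parameter, so that it is attached to the normal quadrilateral facing them. Each tetrahedron has three normal quadrilaterals $q_1\to q_2\to q_3\to q_1$, in the cyclic order given by the orientation. Let $Q$ be the set of all normal quadrilaterals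 of $\mathcal T$, and for an edge $e$ of $\mathcal T$ let $i(q,e)\in\{0,1,2\}$ be the number of edges of the tetrahedron of $q$ that face $q$ and are mapped to $e$. A solution of the hyperbolic gluing equations is a $Z=(z_q)\in(\mathbb C\setminus\{0,1\})^Q$ such that $\prod_{q\in Q}z_q^{i(q,e)}=1$ for every edge $e$ of $\mathcal T$, and $z_{q_{i+1}}=1/(1-z_{q_i})$ in every tetrahedron. A representation $\rho_Z:\pi_1(M)\to PSL(2,\mathbb C)$ is associated to a solution $Z$ if there is a continuous $\rho_Z$-equivariant map $D_Z:\widetilde M\to\overline{\mathbb H^3}=\mathbb H^3\cup S^2_\infty$ taking every $3$-simplex of $\widetilde{\mathcal T}$ to an ideal straight simplex whose shape parameters are those given by $Z$. Here an ideal straight simplex with four distinct vertices in $S^2_\infty$ is a map from the standard $3$-simplex that, in the projective model of $\overline{\mathbb H^3}$, is linear in the barycentric coordinates for some choice of positive weights of the vertices. Theorem. Let $Z$ be a solution of the hyperbolic gluing equations whose associated representation $\rho_Z$ is conjugate to $\rho$ in $PSL(2,\mathbb C)$. Then $Z$ comes from the spinning construction for $\rho$: there is a $\rho$-equivariant map $F:\pi^{-1}(V)\to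 S^2_\infty$ such that, for every $3$-simplex $\sigma$ of $\mathcal T$ and every lift $\widetilde\sigma$ of $\sigma$ to $\widetilde{\mathcal T}$, the images under $F$ of the four vertices of $\widetilde\sigma$ are distinct, and the values of $Z$ on the normal quadrilaterals of $\sigma$ are the corresponding shape parameters of the ideal tetrahedron with these four points as vertices. -/

import Mathlib

open scoped LinearAlgebra.Projectivization MatrixGroups ComplexOrder

noncomputable section

namespace GluingEquations

/-! ### Hyperbolic space, the sphere at infinity, and the action of `PSL(2, ℂ)` -/

/-- The sphere at infinity of hyperbolic 3-space, `ℂ ∪ {∞}` in homogeneous coordinates: `z ∈ ℂ` is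
the line through `(z, 1)` and `∞` is the line through `(1, 0)`. Mathlib provides the action of
`PSL(2, ℂ)` on it, by Möbius transformations. -/
abbrev SphereAtInfinity : Type := ℙ ℂ (Fin 2 → ℂ)

/-- `v ∧ w` for representatives of two points; it is `z - w` for `(z, 1)` and `(w, 1)`. -/
def bracket (x y : SphereAtInfinity) : ℂ := x.rep 0 * y.rep 1 - x.rep 1 * y.rep 0

/-- The cross-ratio `(a, b; c, d) = ((a - c) / (a - d)) * ((b - d) / (b - c))`, written
homogeneously so that the point `∞` is allowed. It does not depend on the representatives. -/
def crossRatio (a b c d : SphereAtInfinity) : ℂ :=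
  (bracket a c / bracket a d) * (bracket b d / bracket b c)

/-- The compactification of hyperbolic 3-space by the sphere at infinity, in the projective (Klein)
model: positive semidefinite Hermitian `2 × 2` matrices up to positive scaling, normalised to have
trace `1`. This is a closed round ball; the positive definite matrices form hyperbolic 3-space, the
matrices of rank one form the sphere at infinity, and geodesics are straight segments. -/
def ClosedHyperbolicSpace : Type :=
  {A : Matrix (Fin 2) (Fin 2) ℂ // A.PosSemidef ∧ A.trace = 1}

instance : TopologicalSpace ClosedHyperbolicSpace :=
  inferInstanceAs (TopologicalSpace {A : Matrix (Fin 2) (Fin 2) ℂ // A.PosSemidef ∧ A.trace = 1})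

theorem trace_conj_ne_zero (g : SL(2, ℂ)) (A : ClosedHyperbolicSpace) :
    (g.1 * A.1 * g.1.conjTranspose).trace ≠ 0 := by
  intro h
  have h0 := ((A.2.1.mul_mul_conjTranspose_same g.1).trace_eq_zero_iff).1 h
  have hg : IsUnit g.1 := by
    rw [Matrix.isUnit_iff_isUnit_det, g.2]; exact isUnit_one
  have hg' : IsUnit g.1.conjTranspose := hg.star
  rw [hg'.mul_left_eq_zero, hg.mul_right_eq_zero] at h0
  have := A.2.2
  rw [h0] at this
  simp at this

/-- `SL(2, ℂ)` acts by isometries, `g • A = g A gᴴ` up to scaling. -/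
instance : MulAction SL(2, ℂ) ClosedHyperbolicSpace where
  smul g A := ⟨((g.1 * A.1 * g.1.conjTranspose).trace)⁻¹ • (g.1 * A.1 * g.1.conjTranspose), by
    have hP := A.2.1.mul_mul_conjTranspose_same g.1
    refine ⟨hP.smul (inv_nonneg_of_nonneg hP.trace_nonneg), ?_⟩
    rw [Matrix.trace_smul, smul_eq_mul, inv_mul_cancel₀ (trace_conj_ne_zero g A)]⟩
  one_smul A := by
    apply Subtype.ext
    change ((((1 : SL(2, ℂ)).1 * A.1 * (1 : SL(2, ℂ)).1.conjTranspose).trace)⁻¹ •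
      ((1 : SL(2, ℂ)).1 * A.1 * (1 : SL(2, ℂ)).1.conjTranspose)) = A.1
    simp [A.2.2]
  mul_smul g h A := by
    apply Subtype.ext
    change (((g * h).1 * A.1 * (g * h).1.conjTranspose).trace)⁻¹ •
        ((g * h).1 * A.1 * (g * h).1.conjTranspose) =
      ((g.1 * (((h.1 * A.1 * h.1.conjTranspose).trace)⁻¹ • (h.1 * A.1 * h.1.conjTranspose)) *
          g.1.conjTranspose).trace)⁻¹ •
        (g.1 * (((h.1 * A.1 * h.1.conjTranspose).trace)⁻¹ • (h.1 * A.1 * h.1.conjTranspose)) *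
          g.1.conjTranspose)
    have e : (g * h).1 * A.1 * (g * h).1.conjTranspose =
        g.1 * (h.1 * A.1 * h.1.conjTranspose) * g.1.conjTranspose := by
      simp [Matrix.SpecialLinearGroup.coe_mul, Matrix.conjTranspose_mul, mul_assoc]
    have hh := trace_conj_ne_zero h A
    rw [e]
    simp only [Matrix.mul_smul, Matrix.smul_mul, Matrix.trace_smul, smul_smul, smul_eq_mul]
    congr 1
    field_simp

theorem coe_smul (g : SL(2, ℂ)) (A : ClosedHyperbolicSpace) :
    (g • A).1 = ((g.1 * A.1 * g.1.conjTranspose).trace)⁻¹ • (g.1 * A.1 * g.1.conjTranspose) := rfl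

theorem center_le_ker :
    Subgroup.center SL(2, ℂ) ≤ (MulAction.toPermHom SL(2, ℂ) ClosedHyperbolicSpace).ker := by
  intro g hg
  obtain ⟨r, hr, hg⟩ := Matrix.SpecialLinearGroup.mem_center_iff.1 hg
  rw [MonoidHom.mem_ker]
  ext A : 1
  apply Subtype.ext
  change (g • A).1 = A.1
  have hr0 : r * (starRingEnd ℂ) r ≠ 0 := by
    have : r ≠ 0 := by rintro rfl; simp at hr
    simpa using this
  rw [coe_smul, ← hg]
  have : Matrix.scalar (Fin 2) r * A.1 * (Matrix.scalar (Fin 2) r).conjTranspose =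
      (r * (starRingEnd ℂ) r) • A.1 := by
    ext i j
    simp [Matrix.scalar_apply, Matrix.diagonal_conjTranspose]
    ring
  rw [this, Matrix.trace_smul, A.2.2, smul_smul]
  rw [smul_eq_mul, mul_one, inv_mul_cancel₀ hr0, one_smul]

/-- The action of `PSL(2, ℂ)`, the group of orientation-preserving isometries. -/
instance : MulAction PSL(2, ℂ) ClosedHyperbolicSpace :=
  MulAction.compHom _ (QuotientGroup.lift (Subgroup.center SL(2, ℂ)) _ center_le_ker)

theorem coe_pslSmul (g : SL(2, ℂ)) (A : ClosedHyperbolicSpace) :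
    (g : PSL(2, ℂ)) • A = g • A := rfl

/-- The rank-one matrix `v vᴴ / (vᴴ v)` of a point at infinity with homogeneous coordinates `v`. -/
def boundaryMatrix (x : SphereAtInfinity) : Matrix (Fin 2) (Fin 2) ℂ :=
  (star x.rep ⬝ᵥ x.rep)⁻¹ • Matrix.vecMulVec x.rep (star x.rep)

/-- `f` is an ideal straight 3-simplex with the points `x 0, …, x 3` at infinity as its vertices:
in projective coordinates it is linear in the barycentric coordinates, for some positive weights of
the vertices (these record the parametrisation; limits of straight simplices whose vertices run
along geodesic rays are exactly of this form). -/
def IsIdealStraightSimplex (f : stdSimplex ℝ (Fin 4) → ClosedHyperbolicSpace)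
    (x : Fin 4 → SphereAtInfinity) : Prop :=
  ∃ c : Fin 4 → ℝ, (∀ i, 0 < c i) ∧
    ∀ t : stdSimplex ℝ (Fin 4),
      (f t).1 = (∑ i, t i * c i)⁻¹ • ∑ i, (t i * c i) • boundaryMatrix (x i)

/-! ### Normal quadrilaterals and shape parameters of one tetrahedron -/

/-- A tetrahedron with vertices labelled by `Fin 4` has three normal quadrilaterals, labelled by
`Fin 3`, one for each pair of opposite edges; `facingQuad a b` is the one facing the edge `ab`.
When the labelling is positively oriented, their cyclic order is `0 → 1 → 2 → 0`. -/
def facingQuad (a b : Fin 4) : Fin 3 :=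
  if s(a, b) = s(0, 1) ∨ s(a, b) = s(2, 3) then 0
  else if s(a, b) = s(0, 2) ∨ s(a, b) = s(1, 3) then 1
  else 2

/-- The four points `x i` are distinct and the ideal tetrahedron that they span has shape parameters
`z`: the parameter at the edge `ij` is the cross-ratio `(x i, x j; x k, x l)` for every even
permutation `(i, j, k, l)` of the labels. -/
def HasShape (x : Fin 4 → SphereAtInfinity) (z : Fin 3 → ℂ) : Prop :=
  Function.Injective x ∧
    ∀ s : Equiv.Perm (Fin 4), Equiv.Perm.sign s = 1 →
      z (facingQuad (s 0) (s 1)) = crossRatio (x (s 0)) (x (s 1)) (x (s 2)) (x (s 3))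

/-! ### Triangulations -/

/-- The vertex `a` of the standard 3-simplex. -/
abbrev vert (a : Fin 4) : stdSimplex ℝ (Fin 4) := stdSimplex.vertex a

theorem lineMap_mem_stdSimplex (x y : stdSimplex ℝ (Fin 4)) (t : unitInterval) :
    (fun c => (1 - (t : ℝ)) * x c + (t : ℝ) * y c) ∈ stdSimplex ℝ (Fin 4) := by
  refine ⟨fun c => ?_, ?_⟩
  · have h1 : (0 : ℝ) ≤ 1 - t := sub_nonneg.2 t.2.2
    exact add_nonneg (mul_nonneg h1 (stdSimplex.zero_le x c))
      (mul_nonneg t.2.1 (stdSimplex.zero_le y c))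
  · rw [Finset.sum_add_distrib, ← Finset.mul_sum, ← Finset.mul_sum, stdSimplex.sum_eq_one,
      stdSimplex.sum_eq_one]
    ring

/-- The straight path from the vertex `a` to the vertex `b` of the standard 3-simplex. -/
def simplexEdge (a b : Fin 4) : Path (vert a) (vert b) where
  toFun t := ⟨fun c => (1 - (t : ℝ)) * (vert a) c + (t : ℝ) * (vert b) c,
    lineMap_mem_stdSimplex (vert a) (vert b) t⟩
  continuous_toFun := by
    refine Continuous.subtype_mk ?_ _
    fun_prop
  source' := by
    apply Subtype.ext; funext c
    change (1 - ((0 : unitInterval) : ℝ)) * (vert a) c + ((0 : unitInterval) : ℝ) * (vert b) c = _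
    rw [Set.Icc.coe_zero, sub_zero, one_mul, zero_mul, add_zero]; rfl
  target' := by
    apply Subtype.ext; funext c
    change (1 - ((1 : unitInterval) : ℝ)) * (vert a) c + ((1 : unitInterval) : ℝ) * (vert b) c = _
    rw [Set.Icc.coe_one, sub_self, one_mul, zero_mul, zero_add]; rfl

/-- A point `x` of the tetrahedron `σ` lying on its face opposite to the vertex `i` is identified
with the corresponding point of the neighbouring tetrahedron `adj σ i`, the vertex `a` of the face
being matched with the vertex `glue σ i a`. -/
inductive FaceStep {n : ℕ} (adj : Fin n → Fin 4 → Fin n)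
    (glue : Fin n → Fin 4 → Equiv.Perm (Fin 4)) :
    Fin n × stdSimplex ℝ (Fin 4) → Fin n × stdSimplex ℝ (Fin 4) → Prop
  | step (σ : Fin n) (i : Fin 4) (x y : stdSimplex ℝ (Fin 4)) (hx : x i = 0)
      (hy : ∀ a, y (glue σ i a) = x a) : FaceStep adj glue (σ, x) (adj σ i, y)

/-- A (possibly singular) triangulation of an oriented closed 3-manifold `M`: the space `M` is
obtained from finitely many tetrahedra by gluing their faces in pairs by affine maps. The vertices
of every tetrahedron are labelled by `Fin 4` in agreement with the orientation of `M`, so that the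
face gluings reverse the induced orientations. The simplices need not be embedded in `M`. -/
structure OrientedTriangulation (M : Type*) [TopologicalSpace M] where
  /-- The number of tetrahedra. -/
  numTet : ℕ
  /-- The tetrahedron glued to `σ` along the face opposite to the vertex `i`. -/
  adj : Fin numTet → Fin 4 → Fin numTet
  /-- The face of `σ` opposite to `i` is glued to the face of `adj σ i` opposite to `glue σ i i`, by
  the affine map which sends every other vertex `a` to `glue σ i a`. -/
  glue : Fin numTet → Fin 4 → Equiv.Perm (Fin 4)
  adj_adj : ∀ σ i, adj (adj σ i) (glue σ i i) = σ
  glue_glue : ∀ σ i, glue (adj σ i) (glue σ i i) = (glue σ i)⁻¹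
  /-- No face is glued to itself. -/
  ne_self : ∀ σ i, (adj σ i, glue σ i i) ≠ (σ, i)
  /-- The gluings are orientation-reversing on the faces. -/
  sign_glue : ∀ σ i, Equiv.Perm.sign (glue σ i) = -1
  /-- The characteristic maps of the tetrahedra. -/
  char : Fin numTet → C(stdSimplex ℝ (Fin 4), M)
  /-- `M` is the quotient of the disjoint union of the tetrahedra by the face gluings. -/
  isQuotientMap : Topology.IsQuotientMap
    (fun s : Fin numTet × stdSimplex ℝ (Fin 4) => char s.1 s.2)
  char_eq_iff : ∀ s t : Fin numTet × stdSimplex ℝ (Fin 4),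
    char s.1 s.2 = char t.1 t.2 ↔ Relation.EqvGen (FaceStep adj glue) s t

namespace OrientedTriangulation

variable {M : Type*} [TopologicalSpace M] (T : OrientedTriangulation M)

/-- The set of vertices of the triangulation. -/
def vertices : Set M := {v | ∃ σ a, T.char σ (vert a) = v}

/-- The edge of the triangulation that is the image of the edge `ab` of `σ`. -/
def edge (σ : Fin T.numTet) (a b : Fin 4) : Set M :=
  T.char σ '' {x | ∀ c, c ≠ a → c ≠ b → x c = 0}

/-- The edge `ab` of `σ`, travelled from `a` to `b`, as a path in `M`. -/
def edgePath (σ : Fin T.numTet) (a b : Fin 4) :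
    Path (T.char σ (vert a)) (T.char σ (vert b)) :=
  (simplexEdge a b).map (T.char σ).continuous

/-- An edge whose end points agree, as a loop. -/
def edgeLoop (σ : Fin T.numTet) (a b : Fin 4) (h : T.char σ (vert a) = T.char σ (vert b)) :
    Path (T.char σ (vert a)) (T.char σ (vert a)) :=
  (T.edgePath σ a b).cast rfl h

/-- No edge is a null-homotopic loop. -/
def HasEssentialEdges : Prop :=
  ∀ (σ : Fin T.numTet) (a b : Fin 4) (h : T.char σ (vert a) = T.char σ (vert b)), a ≠ b →
    ¬ (T.edgeLoop σ a b h).Homotopic (Path.refl _)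

/-- `ρ([e]) ≠ 1` for every edge `e` that is a loop; the class of `e` in the fundamental group is
formed by means of an arbitrary path from the base point to `e`. -/
def NontrivialOnEdgeLoops {x : M} (ρ : FundamentalGroup M x →* PSL(2, ℂ)) : Prop :=
  ∀ (σ : Fin T.numTet) (a b : Fin 4) (h : T.char σ (vert a) = T.char σ (vert b)), a ≠ b →
    ∀ α : Path x (T.char σ (vert a)),
      ρ (FundamentalGroup.fromPath
        (Path.Homotopic.Quotient.mk ((α.trans (T.edgeLoop σ a b h)).trans α.symm))) ≠ 1

/-! ### The hyperbolic gluing equations -/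

/-- The normal quadrilaterals of the triangulation. -/
abbrev Quad : Type := Fin T.numTet × Fin 3

/-- The index `i(q, e)`: the number of edges of the tetrahedron of `q` which face `q` and are mapped
to `e`. -/
def index (q : T.Quad) (e : Set M) : ℕ :=
  {ab : Fin 4 × Fin 4 | ab.1 < ab.2 ∧ facingQuad ab.1 ab.2 = q.2 ∧
    T.edge q.1 ab.1 ab.2 = e}.ncard

/-- The solutions of the hyperbolic gluing equations. -/
def parameterSpace : Set (T.Quad → ℂ) :=
  {Z | (∀ q, Z q ≠ 0 ∧ Z q ≠ 1) ∧
    (∀ (σ : Fin T.numTet) (a b : Fin 4), a ≠ b → ∏ q, Z q ^ T.index q (T.edge σ a b) = 1) ∧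
    ∀ (σ : Fin T.numTet) (k : Fin 3), Z (σ, k + 1) = 1 / (1 - Z (σ, k))}

end OrientedTriangulation

/-! ### The universal cover -/

section Cover

variable {M Mt : Type*} [TopologicalSpace M] [TopologicalSpace Mt] [SimplyConnectedSpace Mt]
  {p : Mt → M} (hp : IsCoveringMap p) (x₀ : Mt)

/-- The action of the fundamental group on the universal cover by deck transformations, with respect
to a base point `x₀` of the cover. If `y` is the end point of the lift from `x₀` of a path `α` in
`M`, then `γ` takes `y` to the end point of the lift from `x₀` of `γ⁻¹` followed by `α`. The inverse
makes this a left action, because in Mathlib the product `γ * δ` is `δ` followed by `γ`. -/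
def deck (γ : FundamentalGroup M (p x₀)) (y : Mt) : Mt :=
  hp.monodromy (γ⁻¹.toPath.trans
    ((Path.Homotopic.Quotient.mk (PathConnectedSpace.somePath x₀ y)).map ⟨p, hp.continuous⟩))
    ⟨x₀, rfl⟩

theorem map_deck (γ : FundamentalGroup M (p x₀)) (y : Mt) : p (deck hp x₀ γ y) = p y :=
  (hp.monodromy (γ⁻¹.toPath.trans
    ((Path.Homotopic.Quotient.mk (PathConnectedSpace.somePath x₀ y)).map ⟨p, hp.continuous⟩))
    ⟨x₀, rfl⟩).2

variable (T : OrientedTriangulation M)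

/-- `s` is a tetrahedron of the lifted triangulation of the cover, lying over `σ`. -/
def IsLift (p : Mt → M) (T : OrientedTriangulation M) (σ : Fin T.numTet)
    (s : C(stdSimplex ℝ (Fin 4), Mt)) : Prop :=
  ∀ t, p (s t) = T.char σ t

/-- The vertices of the lifted triangulation. -/
abbrev LiftedVertex (p : Mt → M) (T : OrientedTriangulation M) : Type _ :=
  {v : Mt // p v ∈ T.vertices}

/-- The vertex `a` of a lifted tetrahedron. -/
def IsLift.vertex {p : Mt → M} {T : OrientedTriangulation M} {σ : Fin T.numTet}
    {s : C(stdSimplex ℝ (Fin 4), Mt)} (hs : IsLift p T σ s) (a : Fin 4) : LiftedVertex p T :=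
  ⟨s (vert a), by rw [hs]; exact ⟨σ, a, rfl⟩⟩

/-- The action of the fundamental group on the lifted vertices. -/
def deckVertex (γ : FundamentalGroup M (p x₀)) (v : LiftedVertex p T) : LiftedVertex p T :=
  ⟨deck hp x₀ γ v.1, (map_deck hp x₀ γ v.1).symm ▸ v.2⟩

/-- `D` is a pseudo-developing map of `Z`: a continuous map from the universal cover to the
compactified hyperbolic space which takes every lifted tetrahedron to an ideal straight simplex
whose shape parameters are those prescribed by `Z`. -/
def IsPseudoDevelopingMap (p : Mt → M) (T : OrientedTriangulation M) (Z : T.Quad → ℂ)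
    (D : Mt → ClosedHyperbolicSpace) : Prop :=
  Continuous D ∧
    ∀ (σ : Fin T.numTet) (s : C(stdSimplex ℝ (Fin 4), Mt)), IsLift p T σ s →
      ∃ x : Fin 4 → SphereAtInfinity,
        HasShape x (fun k => Z (σ, k)) ∧ IsIdealStraightSimplex (fun t => D (s t)) x

/-- `ρ` is an associated representation of `Z`: some pseudo-developing map of `Z` is equivariant
with respect to `ρ`. -/
def IsAssociatedRepresentation (Z : T.Quad → ℂ)
    (ρ : FundamentalGroup M (p x₀) →* PSL(2, ℂ)) : Prop :=
  ∃ D : Mt → ClosedHyperbolicSpace, IsPseudoDevelopingMap p T Z D ∧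
    ∀ γ y, D (deck hp x₀ γ y) = ρ γ • D y

/-- `Z` comes from the spinning construction for `ρ`: there is a `ρ`-equivariant map `F` from the
lifted vertices to the sphere at infinity such that, for every tetrahedron `σ` and every lift of it,
`F` takes distinct values at the four vertices of the lift, and the values of `Z` on the normal
quadrilaterals of `σ` are the shape parameters of the ideal tetrahedron with these vertices. -/
def IsFromSpinning (ρ : FundamentalGroup M (p x₀) →* PSL(2, ℂ)) (Z : T.Quad → ℂ) : Prop :=
  ∃ F : LiftedVertex p T → SphereAtInfinity,
    (∀ γ v, F (deckVertex hp x₀ T γ v) = ρ γ • F v) ∧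
    ∀ (σ : Fin T.numTet) (s : C(stdSimplex ℝ (Fin 4), Mt)) (hs : IsLift p T σ s),
      HasShape (fun a => F (hs.vertex a)) (fun k => Z (σ, k))

end Cover

end GluingEquations

end

namespace GluingEquations

/-! ### Möbius transformations on homogeneous coordinates -/

/-! A pseudo-developing map `D` already contains the spinning data: its restriction to the lifted
vertices is the required `F`. At a vertex of a tetrahedron the barycentric formula of an ideal
straight simplex reduces to the ideal vertex itself (`IsIdealStraightSimplex.apply_vert`), and every
lifted vertex is a vertex of some lifted tetrahedron (`exists_isLift_vert_eq`), so `D` maps all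
lifted vertices to the sphere at infinity. Since `boundaryMatrix` is injective and equivariant, the
equivariance of `D` and the shapes of its simplices pass to `F`. This settles the case of `ρZ`. For
a conjugate representation `F` is moved by an isometry, which preserves shapes because cross-ratios
are Möbius invariant. -/

theorem exists_rep_smul (g : SL(2, ℂ)) (x : SphereAtInfinity) :
    ∃ c : ℂ, c ≠ 0 ∧ (g • x).rep = c • (g.1.mulVec x.rep) := by
  have hx : g.1.mulVec x.rep ≠ 0 := fun h =>
    x.rep_nonzero (Matrix.eq_zero_of_mulVec_eq_zero (by rw [g.2]; exact one_ne_zero) h)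
  have h : g • x = Projectivization.mk ℂ (g.1.mulVec x.rep) hx := by
    conv_lhs => rw [← x.mk_rep]
    rfl
  rw [h]
  obtain ⟨a, ha⟩ := Projectivization.exists_smul_eq_mk_rep ℂ _ hx
  exact ⟨a, a.ne_zero, ha.symm⟩

/-- The bracket is the determinant of the two representatives, and `det g = 1`; only the rescaling
of the chosen representatives remains. -/
theorem bracket_smul (g : SL(2, ℂ)) (x y : SphereAtInfinity) {c d : ℂ}
    (hc : (g • x).rep = c • (g.1.mulVec x.rep)) (hd : (g • y).rep = d • (g.1.mulVec y.rep)) :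
    bracket (g • x) (g • y) = c * d * bracket x y := by
  have hg := g.2
  rw [Matrix.det_fin_two] at hg
  simp only [bracket, hc, hd, Pi.smul_apply, smul_eq_mul, Matrix.mulVec, dotProduct,
    Fin.sum_univ_two]
  linear_combination c * d * (x.rep 0 * y.rep 1 - x.rep 1 * y.rep 0) * hg

/-- Each point occurs once in the numerator and once in the denominator, so the rescaling factors
cancel. -/
theorem crossRatio_smul (g : PSL(2, ℂ)) (x y z w : SphereAtInfinity) :
    crossRatio (g • x) (g • y) (g • z) (g • w) = crossRatio x y z w := by
  induction g using QuotientGroup.induction_on with | H g => ?_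
  simp only [Matrix.ProjectiveSpecialLinearGroup.smul_proj_mk]
  obtain ⟨a, ha, hx⟩ := exists_rep_smul g x
  obtain ⟨b, hb, hy⟩ := exists_rep_smul g y
  obtain ⟨c, hc, hz⟩ := exists_rep_smul g z
  obtain ⟨d, hd, hw⟩ := exists_rep_smul g w
  simp only [crossRatio, bracket_smul g _ _ hx hz, bracket_smul g _ _ hx hw,
    bracket_smul g _ _ hy hw, bracket_smul g _ _ hy hz]
  have h : a * c / (a * d) * (b * d / (b * c)) = 1 := by field_simp
  -- The scalars are split off without cancelling any bracket, so the points need not be distinct.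
  rw [mul_div_mul_comm, mul_div_mul_comm (b * d), mul_mul_mul_comm, h, one_mul]

theorem HasShape.smul (g : PSL(2, ℂ)) {x : Fin 4 → SphereAtInfinity} {z : Fin 3 → ℂ}
    (h : HasShape x z) : HasShape (fun a => g • x a) z :=
  ⟨(MulAction.injective g).comp h.1, fun s hs => by rw [crossRatio_smul, h.2 s hs]⟩

/-! ### The sphere at infinity as the boundary of hyperbolic space -/

theorem star_dotProduct_self_ne_zero {v : Fin 2 → ℂ} (hv : v ≠ 0) : star v ⬝ᵥ v ≠ 0 := by
  rwa [Ne, dotProduct_star_self_eq_zero]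

/-- The matrix of `x` is the orthogonal projection onto the line `x`. It fixes `x.rep`, while the
matrix of `y` sends every vector into the line `y`. -/
theorem boundaryMatrix_injective : Function.Injective boundaryMatrix := by
  intro x y h
  have hx := star_dotProduct_self_ne_zero x.rep_nonzero
  have h1 := congrArg (fun A => A.mulVec x.rep) h
  simp only [boundaryMatrix, Matrix.smul_mulVec, Matrix.vecMulVec_mulVec, op_smul_eq_smul,
    smul_smul, inv_mul_cancel₀ hx, one_smul] at h1
  rw [← x.mk_rep, ← y.mk_rep, Projectivization.mk_eq_mk_iff']
  exact ⟨_, h1.symm⟩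

/-- With `w = g v`, one has `g (v vᴴ) gᴴ = w wᴴ`; normalising the trace removes both the norm of `v`
and the factor `c * star c` from the choice of representative. -/
theorem coe_smul_eq_boundaryMatrix (g : PSL(2, ℂ)) {A : ClosedHyperbolicSpace}
    {x : SphereAtInfinity} (h : A.1 = boundaryMatrix x) : (g • A).1 = boundaryMatrix (g • x) := by
  induction g using QuotientGroup.induction_on with | H g => ?_
  rw [coe_pslSmul, Matrix.ProjectiveSpecialLinearGroup.smul_proj_mk, coe_smul, h]
  obtain ⟨c, hc, hr⟩ := exists_rep_smul g x
  have hn := star_dotProduct_self_ne_zero x.rep_nonzero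
  set w := g.1.mulVec x.rep
  have e : g.1 * boundaryMatrix x * g.1.conjTranspose =
      (star x.rep ⬝ᵥ x.rep)⁻¹ • Matrix.vecMulVec w (star w) := by
    rw [boundaryMatrix, Matrix.mul_smul, Matrix.smul_mul, Matrix.mul_vecMulVec,
      Matrix.vecMulVec_mul, Matrix.star_mulVec]
  have hw : w ≠ 0 := by
    intro h0
    exact (g • x).rep_nonzero (by rw [hr, h0, smul_zero])
  have hwn := star_dotProduct_self_ne_zero hw
  have hc' : star c ≠ 0 := star_ne_zero.2 hc
  rw [e, Matrix.trace_smul, Matrix.trace_vecMulVec, dotProduct_comm w, boundaryMatrix, hr, star_smul,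
    Matrix.vecMulVec_smul, Matrix.smul_vecMulVec, smul_dotProduct, dotProduct_smul]
  simp only [smul_smul, smul_eq_mul]
  congr 1
  field_simp

theorem IsIdealStraightSimplex.apply_vert {f : stdSimplex ℝ (Fin 4) → ClosedHyperbolicSpace}
    {x : Fin 4 → SphereAtInfinity} (h : IsIdealStraightSimplex f x) (a : Fin 4) :
    (f (vert a)).1 = boundaryMatrix (x a) := by
  obtain ⟨c, hc, h⟩ := h
  have hv (i : Fin 4) : (vert a) i = if i = a then 1 else 0 := by
    simp [vert, stdSimplex.vertex, Pi.single_apply]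
  rw [h]
  simp only [hv, ite_mul, one_mul, zero_mul, ite_smul, zero_smul, Finset.sum_ite_eq',
    Finset.mem_univ, if_true, smul_smul]
  -- Only the weight `c a` survives at the vertex, and the normalisation cancels it.
  rw [inv_mul_cancel₀ (hc a).ne', one_smul]

/-! ### Lifts of tetrahedra -/

/-- The straight contraction of the standard 3-simplex to the vertex `a`. -/
noncomputable def simplexContraction (a : Fin 4) :
    C(unitInterval × stdSimplex ℝ (Fin 4), stdSimplex ℝ (Fin 4)) where
  toFun s := ⟨fun c => (1 - (s.1 : ℝ)) * (vert a) c + (s.1 : ℝ) * s.2 c,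
    lineMap_mem_stdSimplex (vert a) s.2 s.1⟩
  continuous_toFun := by
    refine Continuous.subtype_mk (continuous_pi fun c => ?_) _
    have : Continuous fun s : unitInterval × stdSimplex ℝ (Fin 4) => s.2 c :=
      (continuous_apply c).comp (continuous_subtype_val.comp continuous_snd)
    fun_prop

theorem simplexContraction_zero (a : Fin 4) (x : stdSimplex ℝ (Fin 4)) :
    simplexContraction a (0, x) = vert a := by
  apply Subtype.ext; funext c
  change (1 - ((0 : unitInterval) : ℝ)) * (vert a) c + ((0 : unitInterval) : ℝ) * x c = _
  rw [Set.Icc.coe_zero, sub_zero, one_mul, zero_mul, add_zero]; rfl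

theorem simplexContraction_one (a : Fin 4) (x : stdSimplex ℝ (Fin 4)) :
    simplexContraction a (1, x) = x := by
  apply Subtype.ext; funext c
  change (1 - ((1 : unitInterval) : ℝ)) * (vert a) c + ((1 : unitInterval) : ℝ) * x c = _
  rw [Set.Icc.coe_one, sub_self, one_mul, zero_mul, zero_add]; rfl

theorem simplexContraction_vert (a : Fin 4) (t : unitInterval) :
    simplexContraction a (t, vert a) = vert a := by
  apply Subtype.ext; funext c
  change (1 - (t : ℝ)) * (vert a) c + (t : ℝ) * (vert a) c = (vert a) c
  ring

/-- Pushed to `M`, the contraction is a homotopy from the constant map at `p v` to `T.char σ`.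
Lifting it from the constant map at `v` gives the lifted tetrahedron at time `1`. -/
theorem exists_isLift_vert_eq {M Mt : Type*} [TopologicalSpace M] [TopologicalSpace Mt]
    {p : Mt → M} (hp : IsCoveringMap p) {T : OrientedTriangulation M} {σ : Fin T.numTet}
    {a : Fin 4} {v : Mt} (hv : T.char σ (vert a) = p v) :
    ∃ s : C(stdSimplex ℝ (Fin 4), Mt), IsLift p T σ s ∧ s (vert a) = v := by
  let H : C(unitInterval × stdSimplex ℝ (Fin 4), M) := (T.char σ).comp (simplexContraction a)
  have H_0 (x : stdSimplex ℝ (Fin 4)) : H (0, x) = p (ContinuousMap.const _ v x) :=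
    (congrArg (T.char σ) (simplexContraction_zero a x)).trans hv
  let L := hp.liftHomotopy H (ContinuousMap.const _ v) H_0
  refine ⟨L.comp ⟨fun x => (1, x), by fun_prop⟩, fun x => ?_, ?_⟩
  · refine (congrFun (hp.liftHomotopy_lifts H _ H_0) (1, x)).trans ?_
    exact congrArg (T.char σ) (simplexContraction_one a x)
  -- The contraction fixes `vert a`, so the track of this vertex is constant in `M`; its lift is
  -- constant too and ends at `v`.
  · have h : H.comp ⟨fun t => (t, vert a), by fun_prop⟩ = ContinuousMap.const _ (p v) := by
      ext t
      exact (congrArg (T.char σ) (simplexContraction_vert a t)).trans hv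
    change L (1, vert a) = v
    rw [show L (1, vert a) = hp.liftPath (H.comp ⟨fun t => (t, vert a), by fun_prop⟩) v
      (H_0 (vert a)) 1 from rfl]
    simp only [h, hp.liftPath_const rfl, ContinuousMap.const_apply]

/-! ### Developing maps at the vertices -/

theorem IsPseudoDevelopingMap.exists_boundaryMatrix {M Mt : Type*} [TopologicalSpace M]
    [TopologicalSpace Mt] {p : Mt → M} (hp : IsCoveringMap p) {T : OrientedTriangulation M}
    {Z : T.Quad → ℂ} {D : Mt → ClosedHyperbolicSpace} (hD : IsPseudoDevelopingMap p T Z D)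
    (v : LiftedVertex p T) : ∃ x, (D v.1).1 = boundaryMatrix x := by
  obtain ⟨v, σ, a, hv⟩ := v
  obtain ⟨s, hs, rfl⟩ := exists_isLift_vert_eq hp hv
  obtain ⟨x, -, hx⟩ := hD.2 σ s hs
  exact ⟨x a, hx.apply_vert a⟩

theorem isFromSpinning_of_isAssociatedRepresentation {M Mt : Type*} [TopologicalSpace M]
    [TopologicalSpace Mt] [SimplyConnectedSpace Mt] {p : Mt → M} (hp : IsCoveringMap p) (x₀ : Mt)
    {T : OrientedTriangulation M} {ρ : FundamentalGroup M (p x₀) →* PSL(2, ℂ)} {Z : T.Quad → ℂ}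
    (h : IsAssociatedRepresentation hp x₀ T Z ρ) : IsFromSpinning hp x₀ T ρ Z := by
  obtain ⟨D, hD, hDρ⟩ := h
  -- `F v` is determined by `D v` alone, so tetrahedra sharing a vertex agree there.
  choose F hF using hD.exists_boundaryMatrix hp
  refine ⟨F, fun γ v => boundaryMatrix_injective ?_, fun σ s hs => ?_⟩
  · rw [← hF, ← coe_smul_eq_boundaryMatrix (ρ γ) (hF v), ← hDρ]
    rfl
  · obtain ⟨x, hxZ, hx⟩ := hD.2 σ s hs
    have : (fun a => F (hs.vertex a)) = x := funext fun a =>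
      boundaryMatrix_injective ((hF (hs.vertex a)).symm.trans (hx.apply_vert a))
    rwa [this]

theorem IsFromSpinning.of_conj {M Mt : Type*} [TopologicalSpace M]
    [TopologicalSpace Mt] [SimplyConnectedSpace Mt] {p : Mt → M} {hp : IsCoveringMap p} {x₀ : Mt}
    {T : OrientedTriangulation M} {ρ ρ' : FundamentalGroup M (p x₀) →* PSL(2, ℂ)} {Z : T.Quad → ℂ}
    (h : IsFromSpinning hp x₀ T ρ' Z) {g : PSL(2, ℂ)} (hg : ∀ γ, ρ' γ = g * ρ γ * g⁻¹) :
    IsFromSpinning hp x₀ T ρ Z := by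
  obtain ⟨F, hF, hZ⟩ := h
  -- Equivariance is the identity `g⁻¹ * (g * ρ γ * g⁻¹) = ρ γ * g⁻¹`.
  refine ⟨fun v => g⁻¹ • F v, fun γ v => ?_, fun σ s hs => (hZ σ s hs).smul g⁻¹⟩
  beta_reduce
  rw [hF, hg, smul_smul, smul_smul, mul_assoc g, inv_mul_cancel_left]

end GluingEquations

theorem mainTheorem3 {M Mt : Type*} [TopologicalSpace M] [T2Space M] [CompactSpace M]
    [ConnectedSpace M] [ChartedSpace (EuclideanSpace ℝ (Fin 3)) M]
    (T : GluingEquations.OrientedTriangulation M) (hT : T.HasEssentialEdges)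
    [TopologicalSpace Mt] [SimplyConnectedSpace Mt] {p : Mt → M} (hp : IsCoveringMap p) (x₀ : Mt)
    (ρ : FundamentalGroup M (p x₀) →* PSL(2, ℂ)) (hρ : T.NontrivialOnEdgeLoops ρ)
    (Z : T.Quad → ℂ) (hZ : Z ∈ T.parameterSpace)
    (ρZ : FundamentalGroup M (p x₀) →* PSL(2, ℂ))
    (hρZ : GluingEquations.IsAssociatedRepresentation hp x₀ T Z ρZ)
    (hconj : ∃ g : PSL(2, ℂ), ∀ γ, ρZ γ = g * ρ γ * g⁻¹) :
    GluingEquations.IsFromSpinning hp x₀ T ρ Z := by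
  obtain ⟨g, hg⟩ := hconj
  exact (GluingEquations.isFromSpinning_of_isAssociatedRepresentation hp x₀ hρZ).of_conj hg
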